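/- Let $\mathbb{S}=\{x\in\mathbb{R}^3:\|x\|=1\}$ be the unit sphere for the Euclidean norm and let $\sigma=(4\pi)^{-1}\mathrm{Vol}$ be the uniform probability measure on $\mathbb{S}$. For $N\ge 2$ and $x=(x_1,\dots,x_N)\in\mathbb{S}^N$ let $$\mathscr{H}_N(x)=\sum_{i\neq j}\log\frac1{\|x_i-x_j\|}\in\mathbb{R}\cup\{+\infty\}$$ (the sum is over ordered pairs, and $\log\frac10=+\infty$), and for $\beta>0$ let $\mathbb{P}_{N,\beta}$ be the Coulomb gas at inverse temperature $\beta$, the probability measure on $\mathbb{S}^N$ given by $$\mathbb{P}_{N,\beta}(dx)=\frac1{Z_{N,\beta}}e^{-\beta\mathscr{H}_N(x)}\,\sigma^{\otimes N}(dx),\qquad Z_{N,\beta}=\int_{\mathbb{S}^N}e^{-\beta\mathscr{H}_N(x)}\,\sigma^{\otimes N}(dx).$$ Corollary. For every integer $N\ge 2$, the measure $\mathbb{P}_{N,N}$ (that is, $\beta=N$) is a well-defined probability measure, $\mathscr{H}_N$ attains a finite minimum on $\mathbb{S}^N$, and $$\mathbb{P}_{N,N}\Big(\mathscr{H}_N(x)-\min_{\mathbb{S}^N}\mathscr{H}_N\le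 10\log N\Big)\ \ge\ 1-e^{-N\log N}.$$ Moreover, $\mathscr{H}_N$ is $\mathbb{P}_{N,N}$-almost surely finite and $\mathbb{P}_{N,N}$-integrable, and its mean satisfies $$\int_{\mathbb{S}^N}\mathscr{H}_N\,d\mathbb{P}_{N,N}-\min_{\mathbb{S}^N}\mathscr{H}_N\ \le\ 9\log N .$$ -/

import Mathlib

open MeasureTheory

noncomputable section

namespace CoulombGas

/-- The unit sphere `𝕊` of `ℝ³`, with the Euclidean norm. -/
abbrev Sphere : Type := Metric.sphere (0 : EuclideanSpace ℝ (Fin 3)) 1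

/-- The pair interaction `log (1 / ‖x - y‖)`, with values in `ℝ ∪ {+∞}`: it is `+∞` when `x = y`. -/
def logKernel (x y : Sphere) : EReal :=
  open Classical in
  if x = y then ⊤
  else ((Real.log (1 / ‖(x : EuclideanSpace ℝ (Fin 3)) - (y : EuclideanSpace ℝ (Fin 3))‖) : ℝ) :
    EReal)

/-- The logarithmic energy `∑_{i ≠ j} log (1 / ‖x_i - x_j‖)` over ordered pairs `(i, j)`.
No term is `-∞`, so this sum in `EReal` is the usual sum in `ℝ ∪ {+∞}`. -/
def energy {N : ℕ} (x : Fin N → Sphere) : EReal :=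
  ∑ i : Fin N, ∑ j ∈ Finset.univ.erase i, logKernel (x i) (x j)

/-- The uniform probability measure `σ = (4π)⁻¹ Vol` on the sphere. Here
`volume.toSphere` is the surface measure attached to Lebesgue measure on `ℝ³`. -/
def sigma : Measure Sphere :=
  ENNReal.ofReal (4 * Real.pi)⁻¹ • (volume : Measure (EuclideanSpace ℝ (Fin 3))).toSphere

instance sigma_isProbabilityMeasure : IsProbabilityMeasure sigma := by
  constructor
  rw [sigma, Measure.smul_apply, Measure.toSphere_apply_univ, smul_eq_mul,
    EuclideanSpace.volume_ball_fin_three, finrank_euclideanSpace_fin]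
  have h3 : ((3 : ℕ) : ENNReal) = ENNReal.ofReal 3 := by simp
  have hpi := Real.pi_pos
  rw [h3]
  simp only [ENNReal.ofReal_one, one_pow, one_mul]
  rw [← ENNReal.ofReal_mul (by norm_num), ← ENNReal.ofReal_mul (by positivity),
    ← ENNReal.ofReal_one]
  congr 1
  field_simp

/-- The Boltzmann weight `e^{-β H_N(x)}`, equal to `0` when `H_N(x) = +∞` (for `β > 0`). -/
def weight {N : ℕ} (β : ℝ) (x : Fin N → Sphere) : ENNReal :=
  EReal.exp (-((β : EReal) * energy x))

/-- The partition function `Z_{N,β} = ∫ e^{-β H_N} dσ^{⊗N}`. -/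
def partitionFunction (N : ℕ) (β : ℝ) : ENNReal :=
  ∫⁻ x : Fin N → Sphere, weight β x ∂(Measure.pi fun _ => sigma)

/-- The Coulomb gas `P_{N,β}(dx) = Z_{N,β}⁻¹ e^{-β H_N(x)} σ^{⊗N}(dx)` on `𝕊^N`. -/
def gas (N : ℕ) (β : ℝ) : Measure (Fin N → Sphere) :=
  (partitionFunction N β)⁻¹ • (Measure.pi fun _ => sigma).withDensity (weight β)

end CoulombGas

end

/-!
Write `D x = ∏_{i ≠ j} ‖x_i - x_j‖`, so that the energy is `-log D`, the Boltzmann weight at `β = N`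
is `D ^ N`, and the minimal energy is `-log M` with `M = max D`. Everything follows from the lower
bound `M ^ N ≤ (N ^ 7) ^ N * Z` for the partition function `Z = ∫ D ^ N`
(`distProd_pow_le_integral`). Where the energy exceeds its minimum by `10 log N`, the density
`D ^ N / Z` is at most `(N ^ 7 / N ^ 10) ^ N ≤ N ^ (-N)`, which is the tail bound. For the mean,
nonnegativity of the relative entropy of the gas with respect to the uniform measure gives
`N ∫ (-log D) ≤ -log Z ≤ N (7 log N - log M)`.

The lower bound on `Z` is obtained one variable at a time (`le_pow_card_mul_lintegral_pi`). As a
function of `x_i` alone, `D ^ N` is a constant times `f t = (∏_{j ≠ i} ‖t - x_j‖ ^ 2) ^ N`, a product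
of `d = N (N - 1)` squared distances, and `f p ≤ N ^ 7 ∫ f` for each point `p` of the sphere
(`prod_norm_sub_pow_le_integral`). To see this, rotate a point `x` about the axis through `p`. Along
the circle that it describes, `‖x - y‖ ^ 2` is `|A + B e^{iθ}| ^ 2` with
`|A| ^ 2 = (1 + ⟨x, p⟩) / 2 * ‖p - y‖ ^ 2` (`exists_affine_norm_sq`), so `f` is the squared modulus
of a polynomial in `e^{iθ}`, whose mean is at least the squared modulus of its constant term, namely
`((1 + ⟨x, p⟩) / 2) ^ d * f p`. It remains to integrate over `x`: the mean of
`((1 + ⟨x, p⟩) / 2) ^ d` is at least `N ^ (-7)`, already because of the ball of radius `2 / N` about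
`p` (`integral_half_one_add_coord_pow_ge`).
-/

namespace CoulombGas

/-! ### Isometries acting on the sphere -/

/-- The action of a linear isometry of `ℝ³` on the unit sphere. -/
noncomputable def isometryAct
    (T : EuclideanSpace ℝ (Fin 3) ≃ₗᵢ[ℝ] EuclideanSpace ℝ (Fin 3)) (x : Sphere) : Sphere :=
  ⟨T x, by simp⟩

theorem continuous_isometryAct (T : EuclideanSpace ℝ (Fin 3) ≃ₗᵢ[ℝ] EuclideanSpace ℝ (Fin 3)) :
    Continuous (isometryAct T) :=
  Continuous.subtype_mk (T.continuous.comp continuous_subtype_val) _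

open scoped Pointwise in
/-- The uniform measure is invariant under linear isometries, because the cone over the preimage
of a set is the preimage of the cone over it. -/
theorem measurePreserving_isometryAct
    (T : EuclideanSpace ℝ (Fin 3) ≃ₗᵢ[ℝ] EuclideanSpace ℝ (Fin 3)) :
    MeasurePreserving (isometryAct T) sigma sigma := by
  refine ⟨(continuous_isometryAct T).measurable, ?_⟩
  ext s hs
  have hs' := (continuous_isometryAct T).measurable hs
  rw [Measure.map_apply (continuous_isometryAct T).measurable hs, sigma, Measure.smul_apply,
    Measure.smul_apply, Measure.toSphere_apply' _ hs, Measure.toSphere_apply' _ hs']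
  congr 2
  rw [← T.measurePreserving.measure_preimage_emb T.toHomeomorph.measurableEmbedding
    (Set.Ioo (0 : ℝ) 1 • ((Subtype.val : Sphere → EuclideanSpace ℝ (Fin 3)) '' s))]
  congr 1
  ext z
  simp only [Set.mem_smul, Set.mem_image, Set.mem_preimage]
  constructor
  · rintro ⟨r, hr, _, ⟨x, hx, rfl⟩, rfl⟩
    exact ⟨r, hr, _, ⟨_, hx, rfl⟩, by simp [isometryAct]⟩
  · rintro ⟨r, hr, _, ⟨x, hx, rfl⟩, hz⟩
    refine ⟨r, hr, _, ⟨isometryAct T.symm x, ?_, rfl⟩, ?_⟩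
    · convert hx
      simp [isometryAct]
    · apply T.injective
      simp [isometryAct, hz]

theorem integral_comp_isometryAct
    (T : EuclideanSpace ℝ (Fin 3) ≃ₗᵢ[ℝ] EuclideanSpace ℝ (Fin 3)) {f : Sphere → ℝ}
    (hf : Continuous f) : ∫ x, f (isometryAct T x) ∂sigma = ∫ x, f x ∂sigma := by
  conv_rhs => rw [← (measurePreserving_isometryAct T).map_eq]
  rw [integral_map (continuous_isometryAct T).measurable.aemeasurable
    hf.aestronglyMeasurable]

/-- The rotation by the angle `θ` about the first coordinate axis. -/
noncomputable def rotation (θ : ℝ) : EuclideanSpace ℝ (Fin 3) ≃ₗᵢ[ℝ] EuclideanSpace ℝ (Fin 3) where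
  toFun x := !₂[x 0, Real.cos θ * x 1 - Real.sin θ * x 2, Real.sin θ * x 1 + Real.cos θ * x 2]
  invFun x := !₂[x 0, Real.cos θ * x 1 + Real.sin θ * x 2, -Real.sin θ * x 1 + Real.cos θ * x 2]
  map_add' x y := by ext i; fin_cases i <;> simp <;> ring
  map_smul' c x := by ext i; fin_cases i <;> simp <;> ring
  left_inv x := by
    have h := Real.sin_sq_add_cos_sq θ
    ext i
    fin_cases i
    · simp
    · simp; linear_combination (x 1) * h
    · simp; linear_combination (x 2) * h
  right_inv x := by
    have h := Real.sin_sq_add_cos_sq θ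
    ext i
    fin_cases i
    · simp
    · simp; linear_combination (x 1) * h
    · simp; linear_combination (x 2) * h
  norm_map' x := by
    have h := Real.sin_sq_add_cos_sq θ
    simp only [EuclideanSpace.norm_eq, Fin.sum_univ_three, Real.norm_eq_abs, sq_abs]
    congr 1
    simp
    linear_combination (x 1 ^ 2 + x 2 ^ 2) * h

theorem continuous_rotation_act {X : Type*} [TopologicalSpace X] {a : X → ℝ} {b : X → Sphere}
    (ha : Continuous a) (hb : Continuous b) :
    Continuous fun q => isometryAct (rotation (a q)) (b q) := by
  refine Continuous.subtype_mk ?_ _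
  change Continuous fun q => !₂[(b q).1 0,
    Real.cos (a q) * (b q).1 1 - Real.sin (a q) * (b q).1 2,
    Real.sin (a q) * (b q).1 1 + Real.cos (a q) * (b q).1 2]
  refine (PiLp.continuous_toLp 2 _).comp (continuous_pi fun i => ?_)
  fin_cases i <;> simp <;> fun_prop

theorem continuous_rotation_average {f : Sphere → ℝ} (hf : Continuous f) :
    Continuous fun x : Sphere =>
      (2 * Real.pi)⁻¹ * ∫ θ in (0)..(2 * Real.pi), f (isometryAct (rotation θ) x) := by
  have h : Continuous (Function.uncurry fun (x : Sphere) (θ : ℝ) =>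
      f (isometryAct (rotation θ) x)) :=
    hf.comp (continuous_rotation_act continuous_snd continuous_fst)
  have h' := intervalIntegral.continuous_parametric_intervalIntegral_of_continuous' (μ := volume)
    h 0 (2 * Real.pi)
  exact h'.const_mul _

/-- Averaging over the rotations about an axis does not change the integral. -/
theorem integral_eq_integral_rotation_average {f : Sphere → ℝ} (hf : Continuous f) :
    ∫ x, f x ∂sigma =
      ∫ x, ((2 * Real.pi)⁻¹ * ∫ θ in (0)..(2 * Real.pi), f (isometryAct (rotation θ) x)) ∂sigma := by
  have : IsFiniteMeasure (volume.restrict (Set.uIoc 0 (2 * Real.pi))) :=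
    ⟨by simp [Set.uIoc]⟩
  have hint : Integrable (Function.uncurry fun (θ : ℝ) (x : Sphere) =>
      f (isometryAct (rotation θ) x))
      ((volume.restrict (Set.uIoc 0 (2 * Real.pi))).prod sigma) := by
    obtain ⟨C, hC⟩ := isCompact_univ.exists_bound_of_continuousOn hf.continuousOn
    refine Integrable.of_bound (C := C) ?_ (Filter.Eventually.of_forall fun q => hC _ trivial)
    exact (hf.comp (continuous_rotation_act continuous_fst continuous_snd)).aestronglyMeasurable
  rw [integral_const_mul, ← intervalIntegral_integral_swap hint]
  simp only [integral_comp_isometryAct _ hf]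
  have := Real.pi_pos
  simp only [intervalIntegral.integral_const, smul_eq_mul, sub_zero]
  field_simp

/-! ### The average of a product of distances along a circle of latitude -/

theorem sum_sq_coords (x : Sphere) : x.1 0 ^ 2 + x.1 1 ^ 2 + x.1 2 ^ 2 = 1 := by
  have h : ‖x.1‖ ^ 2 = 1 := by simp
  rw [EuclideanSpace.norm_sq_eq, Fin.sum_univ_three] at h
  simpa only [Real.norm_eq_abs, sq_abs] using h

theorem norm_sub_sq_coords (x y : EuclideanSpace ℝ (Fin 3)) :
    ‖x - y‖ ^ 2 = (x 0 - y 0) ^ 2 + (x 1 - y 1) ^ 2 + (x 2 - y 2) ^ 2 := by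
  simp [EuclideanSpace.norm_sq_eq, Fin.sum_univ_three, Real.norm_eq_abs, sq_abs]

/-- The end point of the first coordinate axis. -/
noncomputable def pole : Sphere := ⟨EuclideanSpace.single 0 1, by simp⟩

/-- Here `(h, x₁, x₂)` and `(b, y₁, y₂)` lie on the sphere, so the prescribed moduli of `A` and
`u + i v` are consistent with the prescribed product. -/
theorem exists_moduli_and_product {h x1 x2 b y1 y2 : ℝ} (hx : h ^ 2 + x1 ^ 2 + x2 ^ 2 = 1)
    (hy : b ^ 2 + y1 ^ 2 + y2 ^ 2 = 1) :
    ∃ A u v : ℝ, A ^ 2 = (1 + h) * (1 - b) ∧ u ^ 2 + v ^ 2 = (1 - h) * (1 + b) ∧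
      A * u = -(x1 * y1 + x2 * y2) ∧ A * v = -(x2 * y1 - x1 * y2) := by
  have h1 : 0 ≤ 1 + h := by nlinarith [sq_nonneg x1, sq_nonneg x2]
  have h2 : 0 ≤ 1 - h := by nlinarith [sq_nonneg x1, sq_nonneg x2]
  have h3 : 0 ≤ 1 + b := by nlinarith [sq_nonneg y1, sq_nonneg y2]
  have h4 : 0 ≤ 1 - b := by nlinarith [sq_nonneg y1, sq_nonneg y2]
  have vanish {a c : ℝ} (e : a ^ 2 + c ^ 2 = 0) : a = 0 ∧ c = 0 :=
    ⟨by nlinarith [sq_nonneg a, sq_nonneg c], by nlinarith [sq_nonneg a, sq_nonneg c]⟩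
  rcases (mul_nonneg h1 h4).eq_or_lt with h0 | h0
  · have hprod : x1 * y1 + x2 * y2 = 0 ∧ x2 * y1 - x1 * y2 = 0 := by
      rcases mul_eq_zero.1 h0.symm with e | e
      · obtain ⟨e1, e2⟩ := vanish (a := x1) (c := x2) (by linear_combination hx + (1 - h) * e)
        simp [e1, e2]
      · obtain ⟨e1, e2⟩ := vanish (a := y1) (c := y2) (by linear_combination hy + (1 + b) * e)
        simp [e1, e2]
    refine ⟨0, √((1 - h) * (1 + b)), 0, by simpa using h0, ?_, by simp [hprod.1],
      by simp [hprod.2]⟩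
    rw [Real.sq_sqrt (mul_nonneg h2 h3)]
    ring
  · have hA := Real.sqrt_pos.2 h0
    have hA2 := Real.sq_sqrt h0.le
    refine ⟨√((1 + h) * (1 - b)), -(x1 * y1 + x2 * y2) / √((1 + h) * (1 - b)),
      -(x2 * y1 - x1 * y2) / √((1 + h) * (1 - b)), hA2, ?_, ?_, ?_⟩
    · rw [div_pow, div_pow, ← add_div, hA2, div_eq_iff h0.ne']
      have e1 : x1 ^ 2 + x2 ^ 2 = 1 - h ^ 2 := by linarith
      have e2 : y1 ^ 2 + y2 ^ 2 = 1 - b ^ 2 := by linarith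
      linear_combination (y1 ^ 2 + y2 ^ 2) * e1 + (1 - h ^ 2) * e2
    · field_simp
    · field_simp

/-- On a circle of latitude the squared distance to a fixed point is the squared modulus of an
affine function of `e^{iθ}`, whose constant term has squared modulus the product of `(1 + x₀) / 2`
and the squared distance of `y` to the pole. -/
theorem exists_affine_norm_sq (x y : Sphere) :
    ∃ A B : ℂ, ‖A‖ ^ 2 = (1 + x.1 0) / 2 * ‖pole.1 - y.1‖ ^ 2 ∧
      ∀ θ : ℝ, ‖(isometryAct (rotation θ) x).1 - y.1‖ ^ 2 =
        ‖A + B * circleMap 0 1 θ‖ ^ 2 := by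
  have hx := sum_sq_coords x
  have hy := sum_sq_coords y
  obtain ⟨A, u, v, hA, huv, hu, hv⟩ := exists_moduli_and_product hx hy
  refine ⟨A, ⟨u, v⟩, ?_, fun θ => ?_⟩
  · rw [Complex.norm_real, Real.norm_eq_abs, sq_abs, hA, norm_sub_sq_coords]
    simp only [pole, PiLp.single_apply]
    simp
    linear_combination -(1 + x.1 0) / 2 * hy
  · have hc := Real.sin_sq_add_cos_sq θ
    have e : circleMap 0 1 θ = ⟨Real.cos θ, Real.sin θ⟩ := by
      apply Complex.ext <;>
        simp [circleMap, Complex.exp_ofReal_mul_I_re, Complex.exp_ofReal_mul_I_im]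
    rw [norm_sub_sq_coords, ← Complex.normSq_eq_norm_sq, Complex.normSq_apply, e]
    simp [isometryAct, rotation]
    linear_combination hx + hy + (x.1 1 ^ 2 + x.1 2 ^ 2) * hc - hA - huv -
      2 * Real.cos θ * hu + 2 * Real.sin θ * hv - (u ^ 2 + v ^ 2) * hc

/-- By Parseval's identity the mean over the unit circle of the squared modulus of a polynomial
is at least the squared modulus of its constant term. -/
theorem norm_coeff_zero_sq_le_circleAverage (Q : Polynomial ℂ) :
    ‖Q.coeff 0‖ ^ 2 ≤ Real.circleAverage (fun z => ‖Q.eval z‖ ^ 2) 0 1 := by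
  rw [← Polynomial.sum_sq_norm_coeff_eq_circleAverage]
  by_cases h : Q.coeff 0 = 0
  · simp only [h, norm_zero, ne_eq, OfNat.ofNat_ne_zero, not_false_eq_true, zero_pow]
    positivity
  · exact Finset.single_le_sum (f := fun i => ‖Q.coeff i‖ ^ 2) (fun i _ => by positivity)
      (Polynomial.mem_support_iff.2 h)

/-- The mean of a product of squared distances over a circle of latitude is at least the value of
the product at the pole, times a factor that depends on the latitude only. -/
theorem le_rotation_average {ι : Type*} (s : Finset ι) (y : ι → Sphere) (n : ℕ) (x : Sphere) :
    ((1 + x.1 0) / 2) ^ (s.card * n) * (∏ j ∈ s, ‖pole.1 - (y j).1‖ ^ 2) ^ n ≤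
      (2 * Real.pi)⁻¹ * ∫ θ in (0)..(2 * Real.pi),
        (∏ j ∈ s, ‖(isometryAct (rotation θ) x).1 - (y j).1‖ ^ 2) ^ n := by
  choose A B hA hB using fun j => exists_affine_norm_sq x (y j)
  have h := norm_coeff_zero_sq_le_circleAverage
    ((∏ j ∈ s, (Polynomial.C (A j) + Polynomial.C (B j) * Polynomial.X)) ^ n)
  rw [Real.circleAverage_def, smul_eq_mul] at h
  convert h using 1
  · rw [Polynomial.coeff_zero_eq_eval_zero]
    simp only [Polynomial.eval_pow, Polynomial.eval_prod, Polynomial.eval_add, Polynomial.eval_mul,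
      Polynomial.eval_C, Polynomial.eval_X, mul_zero, add_zero, norm_pow, norm_prod]
    rw [← pow_mul, mul_comm n 2, pow_mul _ 2 n, ← Finset.prod_pow _ 2]
    simp only [hA, Finset.prod_mul_distrib, Finset.prod_const]
    rw [mul_pow, pow_mul]
  · congr 2
    ext θ
    simp only [Polynomial.eval_pow, Polynomial.eval_prod, Polynomial.eval_add, Polynomial.eval_mul,
      Polynomial.eval_C, Polynomial.eval_X, norm_pow, norm_prod]
    rw [← pow_mul, mul_comm n 2, pow_mul, ← Finset.prod_pow _ 2]
    simp only [hB]

/-! ### Comparison of a product of distances with its mean over the sphere -/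

theorem sigma_real_ball_ge (p : Sphere) {ε : ℝ} (hε : 0 < ε) (hε2 : ε ≤ 2) :
    (ε / 4) ^ 3 ≤ sigma.real (Metric.ball p ε) := by
  have h := Measure.toSphereBallBound_mul_measureReal_unitBall_le_toSphere_ball
    (volume : Measure (EuclideanSpace ℝ (Fin 3))) hε p
  have hpi := Real.pi_pos
  have hb : Measure.toSphereBallBound 3 ε = 3 * (Real.toNNReal ε / 4) ^ 3 := by
    unfold Measure.toSphereBallBound
    rw [if_pos ⟨by norm_num, hε⟩, min_eq_left (by simpa using hε2)]
    norm_num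
  rw [finrank_euclideanSpace_fin, hb, Measure.real, EuclideanSpace.volume_ball_fin_three] at h
  simp [hε.le] at h
  rw [ENNReal.toReal_ofReal (by positivity)] at h
  rw [sigma, measureReal_ennreal_smul_apply, ENNReal.toReal_ofReal (by positivity)]
  calc (ε / 4) ^ 3 = (4 * Real.pi)⁻¹ * (3 * (ε / 4) ^ 3 * (Real.pi * 4 / 3)) := by field_simp
    _ ≤ _ := by gcongr

theorem half_one_add_coord (x : Sphere) : (1 + x.1 0) / 2 = 1 - ‖x.1 - pole.1‖ ^ 2 / 4 := by
  have hx := sum_sq_coords x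
  rw [norm_sub_sq_coords]
  simp only [pole, PiLp.single_apply]
  simp
  linear_combination hx / 4

/-- The ball of radius `2 / N` about the pole already carries enough mass. -/
theorem integral_half_one_add_coord_pow_ge {N d : ℕ} (hN : 2 ≤ N) (hd : d ≤ N * (N - 1)) :
    ((N : ℝ) ^ 7)⁻¹ ≤ ∫ x : Sphere, ((1 + x.1 0) / 2) ^ d ∂sigma := by
  have hN' : (2 : ℝ) ≤ N := by exact_mod_cast hN
  have hcont : Continuous fun x : Sphere => ((1 + x.1 0) / 2) ^ d := by fun_prop
  have hint : Integrable (fun x : Sphere => ((1 + x.1 0) / 2) ^ d) sigma :=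
    hcont.integrable_of_hasCompactSupport (HasCompactSupport.of_compactSpace _)
  have hnn (x : Sphere) : 0 ≤ (1 + x.1 0) / 2 := by
    nlinarith [sum_sq_coords x, sq_nonneg (x.1 1), sq_nonneg (x.1 2)]
  have hsq : (0 : ℝ) ≤ 1 - 1 / (N : ℝ) ^ 2 := by
    rw [sub_nonneg, div_le_one (by positivity)]
    nlinarith
  -- Bernoulli's inequality bounds the integrand below by `1 / N` on the ball.
  have hpt : ∀ x ∈ Metric.ball pole (2 / (N : ℝ)), (N : ℝ)⁻¹ ≤ ((1 + x.1 0) / 2) ^ d := by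
    intro x hx
    have hx' : ‖x.1 - pole.1‖ < 2 / N := by
      rwa [Metric.mem_ball, Subtype.dist_eq, dist_eq_norm] at hx
    have h1 : 1 - 1 / (N : ℝ) ^ 2 ≤ (1 + x.1 0) / 2 := by
      rw [half_one_add_coord]
      have : ‖x.1 - pole.1‖ ^ 2 ≤ (2 / N) ^ 2 := by gcongr
      rw [div_pow] at this
      have e : (2 : ℝ) ^ 2 / (N : ℝ) ^ 2 = 4 * (1 / (N : ℝ) ^ 2) := by ring
      linarith
    have h2 := one_add_mul_le_pow (a := -(1 / (N : ℝ) ^ 2)) (by linarith) d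
    have h3 : (d : ℝ) ≤ N * (N - 1) := by
      calc (d : ℝ) ≤ ((N * (N - 1) : ℕ) : ℝ) := by exact_mod_cast hd
        _ = _ := by push_cast [Nat.cast_sub (by omega : 1 ≤ N)]; ring
    calc (N : ℝ)⁻¹ = 1 + (N * (N - 1)) * -(1 / (N : ℝ) ^ 2) := by field_simp; ring
      _ ≤ 1 + d * -(1 / (N : ℝ) ^ 2) := by
          have : 0 ≤ 1 / (N : ℝ) ^ 2 := by positivity
          nlinarith
      _ ≤ (1 + -(1 / (N : ℝ) ^ 2)) ^ d := h2
      _ ≤ _ := by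
          rw [← sub_eq_add_neg]
          gcongr
  have hball : MeasurableSet (Metric.ball pole (2 / (N : ℝ))) := Metric.isOpen_ball.measurableSet
  calc ((N : ℝ) ^ 7)⁻¹ ≤ (2 / N / 4) ^ 3 * (N : ℝ)⁻¹ := by
        have : (8 : ℝ) ≤ N ^ 3 := by
          calc (8 : ℝ) = 2 ^ 3 := by norm_num
            _ ≤ _ := by gcongr
        have e : (2 / (N : ℝ) / 4) ^ 3 * (N : ℝ)⁻¹ = (8 * (N : ℝ) ^ 4)⁻¹ := by
          field_simp
          norm_num
        rw [e]
        apply inv_anti₀ (by positivity)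
        calc 8 * (N : ℝ) ^ 4 ≤ N ^ 3 * N ^ 4 := by gcongr
          _ = _ := by ring
    _ ≤ sigma.real (Metric.ball pole (2 / (N : ℝ))) * (N : ℝ)⁻¹ := by
        gcongr
        exact sigma_real_ball_ge _ (by positivity) ((div_le_self zero_le_two (by linarith)))
    _ = ∫ x in Metric.ball pole (2 / (N : ℝ)), (N : ℝ)⁻¹ ∂sigma := by
        rw [setIntegral_const, smul_eq_mul]
    _ ≤ ∫ x in Metric.ball pole (2 / (N : ℝ)), ((1 + x.1 0) / 2) ^ d ∂sigma :=
        setIntegral_mono_on (integrable_const _).integrableOn hint.integrableOn hball hpt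
    _ ≤ _ := setIntegral_le_integral hint (Filter.Eventually.of_forall fun x => pow_nonneg (hnn x) d)

theorem exists_isometryAct_pole_eq (p : Sphere) :
    ∃ T : EuclideanSpace ℝ (Fin 3) ≃ₗᵢ[ℝ] EuclideanSpace ℝ (Fin 3), isometryAct T pole = p := by
  obtain ⟨b, hb⟩ := Orthonormal.exists_orthonormalBasis_extension_of_card_eq (𝕜 := ℝ)
    (E := EuclideanSpace ℝ (Fin 3)) (ι := Fin 3) (v := fun _ => p.1) (s := {0}) (by simp)
    ⟨fun i => by simp, fun i j hij => (hij (Subsingleton.elim i j)).elim⟩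
  refine ⟨b.repr.symm, Subtype.ext ?_⟩
  simpa [isometryAct, pole] using hb 0 rfl

theorem continuous_prod_norm_sub_pow {ι : Type*} (s : Finset ι) (y : ι → Sphere) (n : ℕ) :
    Continuous fun x : Sphere => (∏ j ∈ s, ‖x.1 - (y j).1‖ ^ 2) ^ n := by fun_prop

theorem prod_norm_pole_sub_pow_le_integral {ι : Type*} (s : Finset ι) (y : ι → Sphere) {N n : ℕ}
    (hN : 2 ≤ N) (hn : s.card * n ≤ N * (N - 1)) :
    (∏ j ∈ s, ‖pole.1 - (y j).1‖ ^ 2) ^ n ≤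
      (N : ℝ) ^ 7 * ∫ x, (∏ j ∈ s, ‖x.1 - (y j).1‖ ^ 2) ^ n ∂sigma := by
  have hN' : (0 : ℝ) < N := by exact_mod_cast (by omega : 0 < N)
  have hf := continuous_prod_norm_sub_pow s y n
  have hleft : Continuous fun x : Sphere => ((1 + x.1 0) / 2) ^ (s.card * n) *
      (∏ j ∈ s, ‖pole.1 - (y j).1‖ ^ 2) ^ n := by fun_prop
  have hright := continuous_rotation_average hf
  have hmean := integral_mono
    (hleft.integrable_of_hasCompactSupport (HasCompactSupport.of_compactSpace _))
    (hright.integrable_of_hasCompactSupport (HasCompactSupport.of_compactSpace _))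
    (le_rotation_average s y n) (μ := sigma)
  rw [← integral_eq_integral_rotation_average hf, integral_mul_const] at hmean
  have hc := integral_half_one_add_coord_pow_ge hN hn
  set F := (∏ j ∈ s, ‖pole.1 - (y j).1‖ ^ 2) ^ n
  have hF : 0 ≤ F := by positivity
  calc F = (N : ℝ) ^ 7 * (((N : ℝ) ^ 7)⁻¹ * F) := by field_simp
    _ ≤ (N : ℝ) ^ 7 * ((∫ x : Sphere, ((1 + x.1 0) / 2) ^ (s.card * n) ∂sigma) * F) := by gcongr
    _ ≤ _ := by gcongr

/-- A product of at most `N (N - 1)` squared distances to fixed points is nowhere larger than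
`N ^ 7` times its mean over the sphere. -/
theorem prod_norm_sub_pow_le_integral {ι : Type*} (s : Finset ι) (y : ι → Sphere) {N n : ℕ}
    (hN : 2 ≤ N) (hn : s.card * n ≤ N * (N - 1)) (p : Sphere) :
    (∏ j ∈ s, ‖p.1 - (y j).1‖ ^ 2) ^ n ≤
      (N : ℝ) ^ 7 * ∫ x, (∏ j ∈ s, ‖x.1 - (y j).1‖ ^ 2) ^ n ∂sigma := by
  obtain ⟨T, rfl⟩ := exists_isometryAct_pole_eq p
  -- Moving `p` to the pole replaces each point `y j` by its image under the inverse isometry.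
  have hT (x : Sphere) (j : ι) : ‖(isometryAct T x).1 - (y j).1‖ =
      ‖x.1 - (isometryAct T.symm (y j)).1‖ := by
    rw [← T.norm_map (x.1 - _)]
    simp [isometryAct]
  rw [← integral_comp_isometryAct T (continuous_prod_norm_sub_pow s y n)]
  simp only [hT]
  exact prod_norm_pole_sub_pow_le_integral s _ hN hn

/-- A function of several variables that is dominated, in each variable, by a multiple of its
integral over that variable is dominated by the corresponding power times its full integral. -/
theorem le_pow_card_mul_lintegral_pi {ι X : Type*} [Fintype ι] [MeasurableSpace X]
    {μ : Measure X} [SigmaFinite μ] {g : (ι → X) → ENNReal} (hg : Measurable g) (C : ENNReal)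
    [DecidableEq ι] (h : ∀ x i, g x ≤ C * ∫⁻ t, g (Function.update x i t) ∂μ) (x : ι → X) :
    g x ≤ C ^ Fintype.card ι * ∫⁻ y, g y ∂(Measure.pi fun _ => μ) := by
  have key (s : Finset ι) : g ≤ C ^ s.card • lmarginal (fun _ => μ) s g := by
    induction s using Finset.induction_on with
    | empty => simp
    | insert i s hi ih =>
      rw [Finset.card_insert_of_notMem hi, lmarginal_insert' _ hg hi]
      refine ih.trans fun x => ?_
      simp only [Pi.smul_apply, smul_eq_mul]
      rw [pow_succ, mul_assoc]
      gcongr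
      have hm : Measurable fun x => ∫⁻ t, g (Function.update x i t) ∂μ := by
        rw [← lmarginal_singleton (μ := fun _ => μ)]
        exact hg.lmarginal _
      calc lmarginal (fun _ => μ) s g x
          ≤ lmarginal (fun _ => μ) s (fun x => C * ∫⁻ t, g (Function.update x i t) ∂μ) x :=
            lmarginal_mono (fun x => h x i) x
        _ = _ := lintegral_const_mul _ (hm.comp measurable_updateFinset)
  simpa using key Finset.univ x

/-! ### The energy as the logarithm of the product of distances -/

/-- The product of the mutual distances over ordered pairs of distinct indices; the energy is minus
its logarithm. -/
noncomputable def distProd {N : ℕ} (x : Fin N → Sphere) : ℝ :=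
  ∏ i : Fin N, ∏ j ∈ Finset.univ.erase i, ‖(x i).1 - (x j).1‖

variable {N : ℕ}

theorem continuous_distProd : Continuous (distProd (N := N)) := by
  unfold distProd
  fun_prop

theorem distProd_nonneg (x : Fin N → Sphere) : 0 ≤ distProd x := by
  unfold distProd
  positivity

theorem distProd_pos_iff {x : Fin N → Sphere} : 0 < distProd x ↔ Function.Injective x := by
  rw [(distProd_nonneg x).lt_iff_ne', distProd]
  simp only [ne_eq, Finset.prod_eq_zero_iff, Finset.mem_univ, true_and, Finset.mem_erase,
    and_true, norm_eq_zero, sub_eq_zero, not_exists, not_and]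
  constructor
  · intro h i j hij
    by_contra hne
    exact h i j (Ne.symm hne) (congrArg _ hij)
  · intro h i j hne hij
    exact hne (h (Subtype.ext hij)).symm

theorem coe_finsetSum_eReal {ι : Type*} (s : Finset ι) (f : ι → ℝ) :
    ((∑ i ∈ s, f i : ℝ) : EReal) = ∑ i ∈ s, (f i : EReal) := by
  classical
  induction s using Finset.induction_on with
  | empty => simp
  | insert i s hi ih => rw [Finset.sum_insert hi, Finset.sum_insert hi, EReal.coe_add, ih]

theorem finsetSum_eReal_ne_bot {ι : Type*} (s : Finset ι) {f : ι → EReal}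
    (h : ∀ i ∈ s, f i ≠ ⊥) : ∑ i ∈ s, f i ≠ ⊥ := by
  classical
  induction s using Finset.induction_on with
  | empty => simp
  | insert i s hi ih =>
    rw [Finset.sum_insert hi, Ne, EReal.add_eq_bot_iff, not_or]
    exact ⟨h i (Finset.mem_insert_self i s),
      ih fun j hj => h j (Finset.mem_insert_of_mem hj)⟩

theorem finsetSum_eReal_eq_top {ι : Type*} {s : Finset ι} {f : ι → EReal}
    (h : ∀ i ∈ s, f i ≠ ⊥) {i : ι} (hi : i ∈ s) (hf : f i = ⊤) : ∑ i ∈ s, f i = ⊤ := by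
  classical
  rw [← Finset.add_sum_erase s f hi, hf]
  exact EReal.top_add_of_ne_bot
    (finsetSum_eReal_ne_bot _ fun j hj => h j (Finset.mem_of_mem_erase hj))

theorem logKernel_ne_bot (x y : Sphere) : logKernel x y ≠ ⊥ := by
  unfold logKernel
  split_ifs <;> simp

theorem energy_of_injective {x : Fin N → Sphere} (hx : Function.Injective x) :
    energy x = ((-Real.log (distProd x) : ℝ) : EReal) := by
  have hne (i : Fin N) (j : Fin N) (hj : j ∈ Finset.univ.erase i) :
      ‖(x i).1 - (x j).1‖ ≠ 0 := by
    rw [norm_ne_zero_iff, sub_ne_zero]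
    exact fun h => (Finset.ne_of_mem_erase hj).symm (hx (Subtype.ext h))
  rw [distProd, Real.log_prod fun i _ => Finset.prod_ne_zero_iff.2 (hne i), energy,
    ← Finset.sum_neg_distrib, coe_finsetSum_eReal]
  refine Finset.sum_congr rfl fun i _ => ?_
  rw [Real.log_prod (hne i), ← Finset.sum_neg_distrib, coe_finsetSum_eReal]
  refine Finset.sum_congr rfl fun j hj => ?_
  rw [logKernel, if_neg fun h => (Finset.ne_of_mem_erase hj).symm (hx h), one_div, Real.log_inv]

theorem energy_of_not_injective {x : Fin N → Sphere} (hx : ¬ Function.Injective x) :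
    energy x = ⊤ := by
  obtain ⟨i, j, hij, hne⟩ := Function.not_injective_iff.1 hx
  refine finsetSum_eReal_eq_top
    (fun k _ => finsetSum_eReal_ne_bot _ fun l _ => logKernel_ne_bot _ _) (Finset.mem_univ i) ?_
  refine finsetSum_eReal_eq_top (fun l _ => logKernel_ne_bot _ _) (i := j) ?_ ?_
  · simpa using Ne.symm hne
  · rw [logKernel, if_pos hij]

/-- When two points coincide, both sides are `0`, by the conventions for `EReal.toReal ⊤` and
`Real.log 0`. -/
theorem toReal_energy (x : Fin N → Sphere) : (energy x).toReal = -Real.log (distProd x) := by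
  by_cases hx : Function.Injective x
  · rw [energy_of_injective hx, EReal.toReal_coe]
  · have h0 : distProd x = 0 :=
      (distProd_nonneg x).eq_of_not_lt' (mt distProd_pos_iff.1 hx)
    simp [energy_of_not_injective hx, h0]

theorem weight_natCast (hN : N ≠ 0) (x : Fin N → Sphere) :
    weight (N : ℝ) x = ENNReal.ofReal (distProd x ^ N) := by
  by_cases hx : Function.Injective x
  · rw [weight, energy_of_injective hx, ← EReal.coe_mul, ← EReal.coe_neg, EReal.exp_coe,
      mul_neg, neg_neg, Real.exp_nat_mul, Real.exp_log (distProd_pos_iff.2 hx)]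
  · have h0 : distProd x = 0 :=
      (distProd_nonneg x).eq_of_not_lt' (mt distProd_pos_iff.1 hx)
    have hN' : (0 : ℝ) < N := by exact_mod_cast Nat.pos_of_ne_zero hN
    rw [weight, energy_of_not_injective hx, EReal.coe_mul_top_of_pos hN', EReal.neg_top,
      EReal.exp_bot, h0, zero_pow hN, ENNReal.ofReal_zero]

/-- Some configuration has the largest product of distances, and its points are distinct because
the sphere is infinite. -/
theorem exists_isMax_distProd (N : ℕ) :
    ∃ x : Fin N → Sphere, 0 < distProd x ∧ ∀ y : Fin N → Sphere, distProd y ≤ distProd x := by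
  have : Nonempty Sphere := ⟨pole⟩
  obtain ⟨x, -, hx⟩ := isCompact_univ.exists_isMaxOn Set.univ_nonempty
    (continuous_distProd (N := N)).continuousOn
  have hinf : Infinite Sphere := by
    have hrank : 1 < Module.rank ℝ (EuclideanSpace ℝ (Fin 3)) := by
      rw [← Module.finrank_eq_rank, finrank_euclideanSpace_fin]
      norm_num
    have : ConnectedSpace Sphere :=
      isConnected_iff_connectedSpace.1 (isConnected_sphere hrank 0 zero_le_one)
    have : Nontrivial Sphere := by
      refine ⟨pole, ⟨-pole.1, by simp⟩, fun h => ?_⟩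
      have h0 := congrArg (fun z : Sphere => z.1 0) h
      simp [pole] at h0
      norm_num at h0
    exact PreconnectedSpace.infinite
  exact ⟨x, (distProd_pos_iff.2 (Infinite.natEmbedding Sphere |>.injective.comp
    Fin.val_injective)).trans_le (hx (Set.mem_univ _)), fun y => hx (Set.mem_univ y)⟩

/-! ### The partition function -/

/-- As a function of the `i`-th point alone, the product of distances is a constant times the
product of squared distances to the other points. -/
theorem distProd_update (x : Fin N → Sphere) (i : Fin N) (t : Sphere) :
    distProd (Function.update x i t) =
      (∏ a ∈ Finset.univ.erase i, ∏ b ∈ (Finset.univ.erase a).erase i, ‖(x a).1 - (x b).1‖) *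
        ∏ j ∈ Finset.univ.erase i, ‖t.1 - (x j).1‖ ^ 2 := by
  have hoff {a : Fin N} (ha : a ∈ Finset.univ.erase i) : Function.update x i t a = x a :=
    Function.update_of_ne (Finset.ne_of_mem_erase ha) _ _
  have hinner : ∀ a ∈ Finset.univ.erase i,
      ∏ b ∈ Finset.univ.erase a,
        ‖(Function.update x i t a).1 - (Function.update x i t b).1‖ =
      (∏ b ∈ (Finset.univ.erase a).erase i, ‖(x a).1 - (x b).1‖) * ‖t.1 - (x a).1‖ := by
    intro a ha
    have hia : i ∈ Finset.univ.erase a := by simpa using (Finset.ne_of_mem_erase ha).symm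
    rw [← Finset.prod_erase_mul _ _ hia, hoff ha, Function.update_self, norm_sub_rev (x a).1 t.1]
    congr 1
    refine Finset.prod_congr rfl fun b hb => ?_
    rw [Function.update_of_ne (Finset.ne_of_mem_erase hb)]
  rw [distProd, ← Finset.prod_erase_mul _ _ (Finset.mem_univ i), Finset.prod_congr rfl hinner,
    Finset.prod_mul_distrib, Function.update_self, mul_assoc]
  congr 1
  rw [Finset.prod_pow, sq]
  congr 1
  exact Finset.prod_congr rfl fun j hj => by rw [hoff hj]

theorem distProd_pow_le_lintegral_update (hN : 2 ≤ N) (x : Fin N → Sphere) (i : Fin N) :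
    ENNReal.ofReal (distProd x ^ N) ≤ ENNReal.ofReal ((N : ℝ) ^ 7) *
      ∫⁻ t, ENNReal.ofReal (distProd (Function.update x i t) ^ N) ∂sigma := by
  have hcont : Continuous fun t : Sphere => distProd (Function.update x i t) ^ N :=
    (continuous_distProd.comp (continuous_const.update i continuous_id)).pow N
  have hint := hcont.integrable_of_hasCompactSupport (μ := sigma)
    (HasCompactSupport.of_compactSpace _)
  rw [← ofReal_integral_eq_lintegral_ofReal hint
    (Filter.Eventually.of_forall fun t => pow_nonneg (distProd_nonneg _) N),
    ← ENNReal.ofReal_mul (by positivity)]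
  apply ENNReal.ofReal_le_ofReal
  have hx := distProd_update x i (x i)
  rw [Function.update_eq_self] at hx
  simp only [distProd_update, mul_pow]
  rw [hx, mul_pow, integral_const_mul, mul_left_comm]
  gcongr
  refine prod_norm_sub_pow_le_integral _ _ hN ?_ _
  rw [Finset.card_erase_of_mem (Finset.mem_univ i), Finset.card_univ, Fintype.card_fin, mul_comm]

theorem distProd_pow_le_integral (hN : 2 ≤ N) (x : Fin N → Sphere) :
    distProd x ^ N ≤ ((N : ℝ) ^ 7) ^ N *
      ∫ y : Fin N → Sphere, distProd y ^ N ∂(Measure.pi fun _ => sigma) := by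
  have hcont : Continuous fun y : Fin N → Sphere => distProd y ^ N := continuous_distProd.pow N
  have h := le_pow_card_mul_lintegral_pi (μ := sigma)
    (g := fun y : Fin N → Sphere => ENNReal.ofReal (distProd y ^ N))
    hcont.measurable.ennreal_ofReal _ (distProd_pow_le_lintegral_update hN) x
  rw [← ofReal_integral_eq_lintegral_ofReal (hcont.integrable_of_hasCompactSupport
      (HasCompactSupport.of_compactSpace _))
    (Filter.Eventually.of_forall fun t => pow_nonneg (distProd_nonneg _) N),
    ← ENNReal.ofReal_pow (by positivity), ← ENNReal.ofReal_mul (by positivity),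
    Fintype.card_fin] at h
  refine (ENNReal.ofReal_le_ofReal_iff ?_).1 h
  have := integral_nonneg (μ := Measure.pi fun _ : Fin N => sigma)
    (f := fun y : Fin N → Sphere => distProd y ^ N) fun y => pow_nonneg (distProd_nonneg y) N
  positivity

theorem gas_natCast_eq_withDensity (hN : N ≠ 0)
    (hZ : 0 < ∫ y : Fin N → Sphere, distProd y ^ N ∂(Measure.pi fun _ => sigma)) :
    gas N (N : ℝ) = (Measure.pi fun _ => sigma).withDensity fun x => ENNReal.ofReal
      (distProd x ^ N / ∫ y : Fin N → Sphere, distProd y ^ N ∂(Measure.pi fun _ => sigma)) := by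
  have hcont : Continuous fun y : Fin N → Sphere => distProd y ^ N := continuous_distProd.pow N
  have hw : weight (N : ℝ) = fun x : Fin N → Sphere => ENNReal.ofReal (distProd x ^ N) :=
    funext (weight_natCast hN)
  rw [gas, partitionFunction, hw, ← ofReal_integral_eq_lintegral_ofReal
    (hcont.integrable_of_hasCompactSupport (HasCompactSupport.of_compactSpace _))
    (Filter.Eventually.of_forall fun t => pow_nonneg (distProd_nonneg _) N),
    ← withDensity_smul _ hcont.measurable.ennreal_ofReal]
  congr 1
  ext x
  rw [Pi.smul_apply, smul_eq_mul, ENNReal.ofReal_div_of_pos hZ, ENNReal.div_eq_inv_mul]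

/-! ### Concentration of the gas near the minimal energy -/

/-- Where the product of distances is at most `M / N ^ 10`, the density of the gas is small. -/
theorem pow_div_le_exp_neg_mul_log {M Z t : ℝ} (hN : 1 ≤ N) (hZ : 0 < Z)
    (hdom : M ^ N ≤ ((N : ℝ) ^ 7) ^ N * Z) (ht : 0 ≤ t) (htM : t ≤ M / (N : ℝ) ^ 10) :
    t ^ N / Z ≤ Real.exp (-((N : ℝ) * Real.log N)) := by
  have hN1 : (1 : ℝ) ≤ N := by exact_mod_cast hN
  have hN0 : (0 : ℝ) < N := by linarith
  rw [Real.exp_neg, Real.exp_nat_mul, Real.exp_log hN0, div_le_iff₀ hZ]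
  calc t ^ N ≤ (M / (N : ℝ) ^ 10) ^ N := pow_le_pow_left₀ ht htM N
    _ = M ^ N * (((N : ℝ) ^ 10) ^ N)⁻¹ := by rw [div_pow, div_eq_mul_inv]
    _ ≤ (((N : ℝ) ^ 7) ^ N * Z) * (((N : ℝ) ^ 10) ^ N)⁻¹ := by gcongr
    _ = (((N : ℝ) ^ 3) ^ N)⁻¹ * Z := by
        rw [show (N : ℝ) ^ 10 = N ^ 7 * N ^ 3 by ring, mul_pow, mul_inv]
        have : ((N : ℝ) ^ 7) ^ N ≠ 0 := by positivity
        field_simp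
    _ ≤ ((N : ℝ) ^ N)⁻¹ * Z := by
        gcongr
        exact le_self_pow₀ hN1 (by norm_num)

end CoulombGas

theorem mainTheorem2 (N : ℕ) (hN : 2 ≤ N) :
    IsProbabilityMeasure (CoulombGas.gas N (N : ℝ)) ∧
    ∃ m : ℝ,
      IsLeast (Set.range (CoulombGas.energy (N := N))) (m : EReal) ∧
      1 - Real.exp (-((N : ℝ) * Real.log N)) ≤
        (CoulombGas.gas N (N : ℝ)).real
          {x | CoulombGas.energy x - (m : EReal) ≤ ((10 * Real.log N : ℝ) : EReal)} ∧
      (∀ᵐ x ∂(CoulombGas.gas N (N : ℝ)), CoulombGas.energy x ≠ ⊤) ∧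
      Integrable (fun x => (CoulombGas.energy x).toReal) (CoulombGas.gas N (N : ℝ)) ∧
      (∫ x, (CoulombGas.energy x).toReal ∂(CoulombGas.gas N (N : ℝ))) - m ≤
        9 * Real.log N := by
  have hN0 : N ≠ 0 := by omega
  have hN' : (0 : ℝ) < N := by exact_mod_cast (by omega : 0 < N)
  have hN1 : (1 : ℝ) ≤ N := by exact_mod_cast (by omega : 1 ≤ N)
  have hlog : 0 ≤ Real.log N := Real.log_nonneg hN1
  obtain ⟨x₀, hM, hmax⟩ := CoulombGas.exists_isMax_distProd N
  have hdom := CoulombGas.distProd_pow_le_integral hN x₀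
  have hgas := CoulombGas.gas_natCast_eq_withDensity hN0
    (pos_of_mul_pos_right ((pow_pos hM N).trans_le hdom) (by positivity))
  have hcont : Continuous (CoulombGas.distProd (N := N)) := CoulombGas.continuous_distProd
  set π := Measure.pi fun _ : Fin N => CoulombGas.sigma with hπ
  set Z := ∫ y : Fin N → CoulombGas.Sphere, CoulombGas.distProd y ^ N ∂π with hZdef
  set M := CoulombGas.distProd x₀ with hMdef
  have hZ : 0 < Z := pos_of_mul_pos_right ((pow_pos hM N).trans_le hdom) (by positivity)
  set p : (Fin N → CoulombGas.Sphere) → ℝ := fun x => CoulombGas.distProd x ^ N / Z with hp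
  have hpcont : Continuous p := (hcont.pow N).div_const Z
  have hpnn (x) : 0 ≤ p x := div_nonneg (pow_nonneg (CoulombGas.distProd_nonneg x) N) hZ.le
  have hpint : Integrable p π :=
    hpcont.integrable_of_hasCompactSupport (HasCompactSupport.of_compactSpace _)
  have hp1 : ∫ x, p x ∂π = 1 := by rw [hp, integral_div, ← hZdef, div_self hZ.ne']
  have hprob : IsProbabilityMeasure (CoulombGas.gas N (N : ℝ)) := by
    constructor
    rw [hgas, withDensity_apply _ MeasurableSet.univ, Measure.restrict_univ,
      ← ofReal_integral_eq_lintegral_ofReal hpint (Filter.Eventually.of_forall hpnn), hp1,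
      ENNReal.ofReal_one]
  -- The integrand `-log D * D ^ N` is continuous, since `t * log t` is.
  have hEcont : Continuous fun x => p x * (CoulombGas.energy x).toReal := by
    have : (fun x => p x * (CoulombGas.energy x).toReal) = fun x =>
        -(CoulombGas.distProd x ^ (N - 1) *
          (CoulombGas.distProd x * Real.log (CoulombGas.distProd x)) / Z) := by
      ext x
      rw [CoulombGas.toReal_energy, hp, ← mul_assoc, ← pow_succ, Nat.sub_add_cancel (by omega)]
      ring
    rw [this]
    exact (((hcont.pow _).mul (Real.continuous_mul_log.comp hcont)).div_const Z).neg
  have hEint : Integrable (fun x => p x * (CoulombGas.energy x).toReal) π :=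
    hEcont.integrable_of_hasCompactSupport (HasCompactSupport.of_compactSpace _)
  have hdens : Measurable fun x => ENNReal.ofReal (p x) := hpcont.measurable.ennreal_ofReal
  have hdens_lt : ∀ᵐ x ∂π, ENNReal.ofReal (p x) < ⊤ :=
    Filter.Eventually.of_forall fun x => ENNReal.ofReal_lt_top
  refine ⟨hprob, -Real.log M, ⟨⟨x₀, ?_⟩, ?_⟩, ?_, ?_, ?_, ?_⟩
  · exact CoulombGas.energy_of_injective (CoulombGas.distProd_pos_iff.1 hM)
  · rintro _ ⟨x, rfl⟩
    by_cases hx : Function.Injective x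
    · rw [CoulombGas.energy_of_injective hx, EReal.coe_le_coe_iff, neg_le_neg_iff]
      exact Real.log_le_log (CoulombGas.distProd_pos_iff.2 hx) (hmax x)
    · rw [CoulombGas.energy_of_not_injective hx]
      exact le_top
  · set A : Set (Fin N → CoulombGas.Sphere) :=
      {x | M / (N : ℝ) ^ 10 ≤ CoulombGas.distProd x} with hA
    have hAmeas : MeasurableSet A := (isClosed_le continuous_const hcont).measurableSet
    have hAsub : A ⊆ {x | CoulombGas.energy x - ((-Real.log M : ℝ) : EReal) ≤
        ((10 * Real.log N : ℝ) : EReal)} := by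
      intro x hx
      have hx' : M / (N : ℝ) ^ 10 ≤ CoulombGas.distProd x := hx
      have hD : 0 < CoulombGas.distProd x := (by positivity : 0 < M / (N : ℝ) ^ 10).trans_le hx'
      have h := Real.log_le_log (by positivity) hx'
      rw [Real.log_div hM.ne' (by positivity), Real.log_pow] at h
      rw [Set.mem_ofPred_eq, CoulombGas.energy_of_injective (CoulombGas.distProd_pos_iff.1 hD),
        ← EReal.coe_sub, EReal.coe_le_coe_iff]
      push_cast at h
      linarith
    have hcompl : (CoulombGas.gas N (N : ℝ)).real Aᶜ ≤ Real.exp (-((N : ℝ) * Real.log N)) := by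
      have hbound : ∀ x ∈ Aᶜ, p x ≤ Real.exp (-((N : ℝ) * Real.log N)) := fun x hx =>
        CoulombGas.pow_div_le_exp_neg_mul_log (by omega) hZ hdom (CoulombGas.distProd_nonneg x)
          (not_le.1 (show ¬ M / (N : ℝ) ^ 10 ≤ CoulombGas.distProd x from hx)).le
      have : CoulombGas.gas N (N : ℝ) Aᶜ ≤
          ENNReal.ofReal (Real.exp (-((N : ℝ) * Real.log N))) := by
        rw [hgas, withDensity_apply _ hAmeas.compl]
        calc ∫⁻ x in Aᶜ, ENNReal.ofReal (p x) ∂π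
            ≤ ∫⁻ x in Aᶜ, ENNReal.ofReal (Real.exp (-((N : ℝ) * Real.log N))) ∂π :=
              setLIntegral_mono measurable_const fun x hx =>
                ENNReal.ofReal_le_ofReal (hbound x hx)
          _ ≤ _ := by
              rw [setLIntegral_const]
              exact mul_le_of_le_one_right' prob_le_one
      exact ENNReal.toReal_le_of_le_ofReal (Real.exp_pos _).le this
    have hadd := probReal_add_probReal_compl (μ := CoulombGas.gas N (N : ℝ)) hAmeas
    have hmono := measureReal_mono (μ := CoulombGas.gas N (N : ℝ)) hAsub
    linarith
  · rw [hgas, ae_withDensity_iff hdens]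
    refine Filter.Eventually.of_forall fun x hx htop => hx ?_
    have hinj : ¬ Function.Injective x := fun h => by
      rw [CoulombGas.energy_of_injective h] at htop
      exact EReal.coe_ne_top _ htop
    have h0 : CoulombGas.distProd x = 0 := (CoulombGas.distProd_nonneg x).eq_of_not_lt'
      (mt CoulombGas.distProd_pos_iff.1 hinj)
    simp [hp, h0, hN0]
  · rw [hgas, integrable_withDensity_iff_integrable_smul' hdens hdens_lt]
    simpa only [ENNReal.toReal_ofReal (hpnn _), smul_eq_mul] using hEint
  · rw [hgas, integral_withDensity_eq_integral_toReal_smul hdens hdens_lt]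
    simp only [ENNReal.toReal_ofReal (hpnn _), smul_eq_mul]
    -- Nonnegativity of the relative entropy `∫ p log p`, in the pointwise form `p log p ≥ p - 1`.
    have hpt (x) : (N : ℝ) * (p x * (CoulombGas.energy x).toReal) + Real.log Z * p x ≤
        1 - p x := by
      rcases (CoulombGas.distProd_nonneg x).eq_or_lt with h0 | h0
      · have : p x = 0 := by simp [hp, ← h0, hN0]
        simp [this]
      · have hpx : 0 < p x := div_pos (pow_pos h0 N) hZ
        have hlogp : Real.log (p x) =
            N * Real.log (CoulombGas.distProd x) - Real.log Z := by
          rw [hp, Real.log_div (pow_pos h0 N).ne' hZ.ne', Real.log_pow]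
        rw [CoulombGas.toReal_energy]
        have h := Real.one_sub_inv_le_log_of_pos hpx
        have h' := mul_le_mul_of_nonneg_left h hpx.le
        rw [mul_sub, mul_inv_cancel₀ hpx.ne', hlogp] at h'
        linarith
    have hI := integral_mono (μ := π) ((hEint.const_mul (N : ℝ)).add (hpint.const_mul (Real.log Z)))
      ((integrable_const (1 : ℝ)).sub hpint) hpt
    simp only [Pi.add_apply, Pi.sub_apply] at hI
    rw [integral_add (hEint.const_mul _) (hpint.const_mul _), integral_const_mul,
      integral_const_mul, integral_sub (integrable_const _) hpint, hp1] at hI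
    simp at hI
    have hlogZ := Real.log_le_log (pow_pos hM N) hdom
    rw [Real.log_mul (by positivity) hZ.ne', Real.log_pow, Real.log_pow, Real.log_pow] at hlogZ
    push_cast at hlogZ
    set I := ∫ x, p x * (CoulombGas.energy x).toReal ∂π
    have : (N : ℝ) * (I + Real.log M) ≤ N * (7 * Real.log N) := by linarith
    have := le_of_mul_le_mul_left this hN'
    linarith
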